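/- Let $n\ge 0$ be an integer, let $s\in(0,1)$ and put $a=1-2s\in(-1,1)$. Denote points of $\mathbb{R}^{n+1}$ by $(x,y)$ with $x\in\mathbb{R}^n$, $y\in\mathbb{R}$, let $\mathbb{R}^{n+1}_+=\{(x,y): y>0\}$, and let \[L_a u=\operatorname{div}_{x,y}\bigl(y^a\nabla_{x,y}u\bigr).\] Let $u\in C(\overline{\mathbb{R}^{n+1}_+})\cap C^2(\mathbb{R}^{n+1}_+)$ satisfy, for some constants $C\in\mathbb{R}$ and $\varepsilon>0$, (1) $L_a u=0$ in $\mathbb{R}^{n+1}_+$; (2) $D^2_x u\ge 0$ in $\mathbb{R}^{n+1}_+$, i.e. the Hessian of $u$ in the variables $x$ is positive semidefinite at every point; (3) $|u(x,y)|\le C(1+|x|+|y|)^{2-\varepsilon}$ in $\mathbb{R}^{n+1}_+$; (4) $u(x,0)\ge 0$ for every $x\in\mathbb{R}^n$; (5) for every $x\in\mathbb{R}^n$ the limit $\lim_{y\downarrow 0}y^a\partial_y u(x,y)$ exists in $[0,+\infty]$; (6) $u(0,0)=0$; (7) $\lim_{y\downarrow 0}y^a\partial_y u(0,y)=0$. Then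 $u\equiv 0$ on $\overline{\mathbb{R}^{n+1}_+}$. -/

import Mathlib

open Filter Topology

/-- The ambient space of the upper half-space: points `(x, y)` with `x ∈ ℝⁿ` (Euclidean norm) and
`y ∈ ℝ`. -/
abbrev ExtSpace (n : ℕ) : Type := EuclideanSpace ℝ (Fin n) × ℝ

/-- The open upper half-space `{(x, y) : y > 0}`. -/
def openHalf (n : ℕ) : Set (ExtSpace n) := {p | 0 < p.2}

/-- The closed upper half-space `{(x, y) : y ≥ 0}`. -/
def closedHalf (n : ℕ) : Set (ExtSpace n) := {p | 0 ≤ p.2}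

/-- The partial derivative `∂_{x_i} u`. -/
noncomputable def dX {n : ℕ} (i : Fin n) (u : ExtSpace n → ℝ) (p : ExtSpace n) : ℝ :=
  fderiv ℝ u p (EuclideanSpace.single i 1, 0)

/-- The partial derivative `∂_y u`. -/
noncomputable def dY {n : ℕ} (u : ExtSpace n → ℝ) (p : ExtSpace n) : ℝ :=
  fderiv ℝ u p (0, 1)

/-- The operator `L_a u = div_{x,y} (y^a ∇_{x,y} u)`. -/
noncomputable def extOp {n : ℕ} (a : ℝ) (u : ExtSpace n → ℝ) (p : ExtSpace n) : ℝ :=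
  (∑ i : Fin n, dX i (fun q => q.2 ^ a * dX i u q) p) + dY (fun q => q.2 ^ a * dY u q) p

/-- The Hessian of `u` in the variables `x` at `p = (x, y)`, as a bilinear form, evaluated at
`(ξ, η)`. -/
noncomputable def hessX {n : ℕ} (u : ExtSpace n → ℝ) (p : ExtSpace n)
    (ξ η : EuclideanSpace ℝ (Fin n)) : ℝ :=
  fderiv ℝ (fun x => fderiv ℝ (fun x' => u (x', p.2)) x) p.1 ξ η

/-- The weighted derivative `y ↦ y^a ∂_y u(x, y)`; its limit as `y ↓ 0` is the weighted normal
derivative of `u` at the boundary point `(x, 0)`. -/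
noncomputable def weightedDY {n : ℕ} (a : ℝ) (u : ExtSpace n → ℝ)
    (x : EuclideanSpace ℝ (Fin n)) (y : ℝ) : ℝ :=
  y ^ a * dY u (x, y)

/-! Put b = 1 - a = 2s ∈ (0, 2). Convexity in x gives Δₓu ≥ 0, so the equation makes y^a ∂ᵧu
nonincreasing in y (`antitone_weightedDY`): on each vertical line u is concave as a function of y^b.

The crux is that u is nondecreasing in y. Concavity bounds the slopes in y^b on (0, R] below by the
slope over [R, 2R], and the growth bounds that one below by -K R^(q - b), where q < 2 is the growth
exponent (`slope_bound_of_growth`). This controls u(x, y₂) - u(x, y₁) on the sides and top of the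
region ‖x‖ ≤ R, 0 ≤ y₁ ≤ y₂ ≤ R. A maximum principle for this difference, with a barrier added
(`HasPurePartials.mono_of_strictAnti_op`), carries the control inside; the nonnegative flux rules
out a minimum at y₁ = 0. The error in `HasPurePartials.sub_le_of_slope_bound` vanishes as R → ∞
because the growth is subquadratic.

Hence u(x, y) ≥ u(x, 0) ≥ 0. On the axis x = 0 the weighted derivative starts at 0 and does not
increase, so u(0, y) ≤ 0 and u vanishes there. A positive value at (x, y) would persist at (x, Y)
for every Y ≥ y; once Y ≥ 2‖x‖, `HasPurePartials.pos_of_pos` spreads it to the axis, a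
contradiction. -/

/-! ### Second-order calculus along coordinate lines -/

theorem IsLocalMin.second_deriv_nonneg {f f' : ℝ → ℝ} {c t₀ : ℝ} (hmin : IsLocalMin f t₀)
    (hf : ∀ᶠ t in 𝓝 t₀, HasDerivAt f (f' t) t) (hf' : HasDerivAt f' c t₀) : 0 ≤ c := by
  by_contra! hc
  have hd : deriv f =ᶠ[𝓝 t₀] f' := hf.mono fun t ht => ht.deriv
  have hdd : deriv (deriv f) t₀ = c := hd.deriv_eq.trans hf'.deriv
  -- A negative second derivative would make the minimum a local maximum as well, so f would be
  -- locally constant and c would be 0.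
  have hmax : IsLocalMax f t₀ :=
    isLocalMax_of_deriv_deriv_neg (hdd ▸ hc) hmin.deriv_eq_zero hf.self_of_nhds.continuousAt
  have hconst : f =ᶠ[𝓝 t₀] fun _ => f t₀ := by
    filter_upwards [hmin, hmax] with t h1 h2 using le_antisymm h2 h1
  have h0 : deriv (deriv f) t₀ = 0 := by
    rw [hconst.deriv.deriv_eq]; simp
  linarith

/-- `gy, gyy` are the first and second derivatives of `g` in `y` and `gx i, gxx i` those in `x_i`,
at every point of the open half-space. -/
structure HasPurePartials {n : ℕ} (g gy gyy : ExtSpace n → ℝ)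
    (gx gxx : Fin n → ExtSpace n → ℝ) : Prop where
  y1 : ∀ x y, 0 < y → HasDerivAt (fun t : ℝ => g (x, t)) (gy (x, y)) y
  y2 : ∀ x y, 0 < y → HasDerivAt (fun t : ℝ => gy (x, t)) (gyy (x, y)) y
  x1 : ∀ i x y, 0 < y → ∀ t : ℝ, HasDerivAt
    (fun t : ℝ => g (x + t • EuclideanSpace.single i 1, y))
    (gx i (x + t • EuclideanSpace.single i 1, y)) t
  x2 : ∀ i x y, 0 < y → ∀ t : ℝ, HasDerivAt
    (fun t : ℝ => gx i (x + t • EuclideanSpace.single i 1, y))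
    (gxx i (x + t • EuclideanSpace.single i 1, y)) t

theorem HasPurePartials.add {n : ℕ} {g gy gyy : ExtSpace n → ℝ} {gx gxx : Fin n → ExtSpace n → ℝ}
    {h hy hyy : ExtSpace n → ℝ} {hx hxx : Fin n → ExtSpace n → ℝ}
    (Hg : HasPurePartials g gy gyy gx gxx) (Hh : HasPurePartials h hy hyy hx hxx) :
    HasPurePartials (g + h) (gy + hy) (gyy + hyy) (gx + hx) (gxx + hxx) where
  y1 x y hy := (Hg.y1 x y hy).add (Hh.y1 x y hy)
  y2 x y hy := (Hg.y2 x y hy).add (Hh.y2 x y hy)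
  x1 i x y hy t := (Hg.x1 i x y hy t).add (Hh.x1 i x y hy t)
  x2 i x y hy t := (Hg.x2 i x y hy t).add (Hh.x2 i x y hy t)

theorem isOpen_openHalf (n : ℕ) : IsOpen (openHalf n) :=
  isOpen_lt continuous_const continuous_snd

theorem DifferentiableAt.hasDerivAt_dY {n : ℕ} {h : ExtSpace n → ℝ}
    {x : EuclideanSpace ℝ (Fin n)} {y : ℝ} (hd : DifferentiableAt ℝ h (x, y)) :
    HasDerivAt (fun t : ℝ => h (x, t)) (dY h (x, y)) y := by
  have hc : HasDerivAt (fun t : ℝ => ((x, t) : ExtSpace n)) (0, 1) y :=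
    (hasDerivAt_const y x).prodMk (hasDerivAt_id y)
  exact hd.hasFDerivAt.comp_hasDerivAt y hc

theorem DifferentiableAt.hasDerivAt_dX {n : ℕ} {h : ExtSpace n → ℝ} (i : Fin n)
    {x : EuclideanSpace ℝ (Fin n)} {y t : ℝ}
    (hd : DifferentiableAt ℝ h (x + t • EuclideanSpace.single i 1, y)) :
    HasDerivAt (fun t : ℝ => h (x + t • EuclideanSpace.single i 1, y))
      (dX i h (x + t • EuclideanSpace.single i 1, y)) t := by
  have h1 : HasDerivAt (fun t : ℝ => x + t • EuclideanSpace.single i (1 : ℝ))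
      (EuclideanSpace.single i 1) t := by
    simpa using ((hasDerivAt_id t).smul_const (EuclideanSpace.single i (1 : ℝ))).const_add x
  have hc := h1.prodMk (hasDerivAt_const t y)
  exact hd.hasFDerivAt.comp_hasDerivAt t hc

theorem ContDiffOn.differentiableAt_openHalf {n : ℕ} {u : ExtSpace n → ℝ}
    (hC2 : ContDiffOn ℝ 2 u (openHalf n))
    {p : ExtSpace n} (hp : p ∈ openHalf n) :
    DifferentiableAt ℝ u p :=
  (hC2.contDiffAt ((isOpen_openHalf n).mem_nhds hp)).differentiableAt (by norm_num)

theorem ContDiffOn.differentiableAt_fderiv_openHalf {n : ℕ} {u : ExtSpace n → ℝ}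
    (hC2 : ContDiffOn ℝ 2 u (openHalf n))
    {p : ExtSpace n} (hp : p ∈ openHalf n) :
    DifferentiableAt ℝ (fderiv ℝ u) p :=
  ((hC2.contDiffAt ((isOpen_openHalf n).mem_nhds hp)).fderiv_right
    (m := 1) (by norm_num)).differentiableAt (by norm_num)

theorem ContDiffOn.differentiableAt_dY {n : ℕ} {u : ExtSpace n → ℝ}
    (hC2 : ContDiffOn ℝ 2 u (openHalf n))
    {p : ExtSpace n} (hp : p ∈ openHalf n) :
    DifferentiableAt ℝ (dY u) p :=
  (hC2.differentiableAt_fderiv_openHalf hp).clm_apply (differentiableAt_const _)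

theorem ContDiffOn.differentiableAt_dX {n : ℕ} {u : ExtSpace n → ℝ}
    (hC2 : ContDiffOn ℝ 2 u (openHalf n))
    {p : ExtSpace n} (hp : p ∈ openHalf n) (i : Fin n) :
    DifferentiableAt ℝ (dX i u) p :=
  (hC2.differentiableAt_fderiv_openHalf hp).clm_apply (differentiableAt_const _)

theorem ContDiffOn.hasPurePartials {n : ℕ} {u : ExtSpace n → ℝ}
    (hC2 : ContDiffOn ℝ 2 u (openHalf n)) :
    HasPurePartials u (dY u) (dY (dY u)) (fun i => dX i u) (fun i => dX i (dX i u)) where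
  y1 _ _ hy := (hC2.differentiableAt_openHalf hy).hasDerivAt_dY
  y2 _ _ hy := (hC2.differentiableAt_dY hy).hasDerivAt_dY
  x1 i _ _ hy _ := DifferentiableAt.hasDerivAt_dX i (hC2.differentiableAt_openHalf hy)
  x2 i _ _ hy _ := DifferentiableAt.hasDerivAt_dX i (hC2.differentiableAt_dX hy i)

/-- The chain rule along the slice x ↦ (x, y) lets the convexity hypothesis, stated on slices, bound
the terms of the equation. -/
theorem ContDiffOn.hessX_single {n : ℕ} {u : ExtSpace n → ℝ}
    (hC2 : ContDiffOn ℝ 2 u (openHalf n))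
    {p : ExtSpace n} (hp : p ∈ openHalf n) (i : Fin n) :
    hessX u p (EuclideanSpace.single i 1) (EuclideanSpace.single i 1) = dX i (dX i u) p := by
  obtain ⟨x, y⟩ := p
  have hv : ContDiff ℝ 2 (fun x' => u (x', y)) := by
    rw [← contDiffOn_univ]
    exact hC2.comp (contDiff_id.prodMk contDiff_const).contDiffOn fun _ _ => hp
  have hv' : Differentiable ℝ (fderiv ℝ (fun x' => u (x', y))) :=
    (hv.fderiv_right (m := 1) (by norm_num)).differentiable (by norm_num)
  set e := EuclideanSpace.single i (1 : ℝ) with he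
  have hpart : ∀ z, fderiv ℝ (fun x' => u (x', y)) z e = dX i u (z, y) := by
    intro z
    have h1 := HasFDerivAt.comp (g := u) (f := fun e => (e, y)) z
      (hC2.differentiableAt_openHalf (p := (z, y)) hp).hasFDerivAt (hasFDerivAt_prodMk_left z y)
    have h2 := h1.fderiv
    change fderiv ℝ (fun x' => u (x', y)) z = _ at h2
    rw [h2]
    simp [dX, he]
  have h1 : HasFDerivAt (fun z => fderiv ℝ (fun x' => u (x', y)) z e) _ x :=
    (hv' x).hasFDerivAt.clm_apply (hasFDerivAt_const e x)
  have h2 := HasFDerivAt.comp (g := dX i u) (f := fun e => (e, y)) x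
    (hC2.differentiableAt_dX (p := (x, y)) hp i).hasFDerivAt (hasFDerivAt_prodMk_left x y)
  have h3 : (fun z => fderiv ℝ (fun x' => u (x', y)) z e) = (fun z => dX i u (z, y)) :=
    funext hpart
  rw [h3] at h1
  have h4 := congrArg (fun L => L e) (h1.unique h2)
  simp at h4
  simpa [hessX, dX, he] using h4

/-- Nondivergence form: the positive factor y^a can then be cancelled, leaving the singular drift a
/ y. -/
theorem ContDiffOn.extOp_eq {n : ℕ} {u : ExtSpace n → ℝ}
    (hC2 : ContDiffOn ℝ 2 u (openHalf n))
    {a : ℝ} {p : ExtSpace n} (hp : p ∈ openHalf n) :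
    extOp a u p =
      p.2 ^ a * (∑ i, dX i (dX i u) p + dY (dY u) p + a / p.2 * dY u p) := by
  obtain ⟨x, y⟩ := p
  have hy : 0 < y := hp
  have hpow : DifferentiableAt ℝ (fun q : ExtSpace n => q.2 ^ a) (x, y) :=
    differentiableAt_snd.rpow_const (Or.inl hy.ne')
  have hX : ∀ i, dX i (fun q => q.2 ^ a * dX i u q) (x, y) = y ^ a * dX i (dX i u) (x, y) := by
    intro i
    have hx : x + (0 : ℝ) • EuclideanSpace.single i (1 : ℝ) = x := by simp
    have h1 := DifferentiableAt.hasDerivAt_dX (h := fun q => q.2 ^ a * dX i u q) i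
      (x := x) (y := y) (t := 0)
      (by rw [hx]; exact hpow.mul (hC2.differentiableAt_dX hp i))
    have h2 := (DifferentiableAt.hasDerivAt_dX (h := dX i u) i (x := x) (y := y) (t := 0)
      (by rw [hx]; exact hC2.differentiableAt_dX hp i)).const_mul (y ^ a)
    have h3 := h1.unique h2
    rwa [hx] at h3
  have hY : dY (fun q => q.2 ^ a * dY u q) (x, y) =
      a * y ^ (a - 1) * dY u (x, y) + y ^ a * dY (dY u) (x, y) := by
    have h1 := DifferentiableAt.hasDerivAt_dY (hpow.mul (hC2.differentiableAt_dY hp))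
    have h2 := (Real.hasDerivAt_rpow_const (p := a) (Or.inl hy.ne')).mul
      (hC2.differentiableAt_dY hp).hasDerivAt_dY
    exact h1.unique h2
  simp only [extOp, hX, hY, Real.rpow_sub_one hy.ne', ← Finset.mul_sum]
  ring

/-! ### Maximum principle in the doubled vertical variable -/

theorem continuousOn_slice {n : ℕ} {g : ExtSpace n → ℝ} (hcont : ContinuousOn g (closedHalf n))
    (x : EuclideanSpace ℝ (Fin n)) : ContinuousOn (fun t : ℝ => g (x, t)) (Set.Ici 0) :=
  hcont.comp (Continuous.prodMk_right x).continuousOn fun _ ht => ht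

/-- A maximum principle in the doubled vertical variable: if the flux of `g` through `y = 0` is
positive, `(Δₓ + ∂ᵧ² + (a / y) ∂ᵧ) g` is strictly decreasing in `y`, and `g` is monotone in `y`
across the lateral and upper boundary of a cylinder, then `g` is monotone in `y` on the cylinder. -/
theorem HasPurePartials.mono_of_strictAnti_op {n : ℕ} {g gy gyy : ExtSpace n → ℝ}
    {gx gxx : Fin n → ExtSpace n → ℝ} (H : HasPurePartials g gy gyy gx gxx) {a R : ℝ}
    (hcont : ContinuousOn g (closedHalf n))
    (hop : ∀ x y₁ y₂, 0 < y₁ → y₁ < y₂ →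
      ∑ i, gxx i (x, y₂) + gyy (x, y₂) + a / y₂ * gy (x, y₂) <
      ∑ i, gxx i (x, y₁) + gyy (x, y₁) + a / y₁ * gy (x, y₁))
    (hflux : ∀ x, ∀ᶠ y in 𝓝[>] (0 : ℝ), 0 < gy (x, y))
    (hside : ∀ x y₁ y₂, ‖x‖ = R → 0 < y₁ → y₁ < y₂ → y₂ ≤ R → g (x, y₁) ≤ g (x, y₂))
    (htop : ∀ x y₁, ‖x‖ ≤ R → 0 < y₁ → y₁ < R → g (x, y₁) ≤ g (x, R))
    {x : EuclideanSpace ℝ (Fin n)} {y₁ y₂ : ℝ} (hx : ‖x‖ ≤ R) (h0 : 0 ≤ y₁) (h12 : y₁ ≤ y₂)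
    (h2R : y₂ ≤ R) : g (x, y₁) ≤ g (x, y₂) := by
  let K : Set (EuclideanSpace ℝ (Fin n) × ℝ × ℝ) :=
    (Metric.closedBall 0 R ×ˢ (Set.Icc 0 R ×ˢ Set.Icc 0 R)) ∩ {q | q.2.1 ≤ q.2.2}
  have hKmem : ∀ x s t, (x, s, t) ∈ K ↔ ‖x‖ ≤ R ∧ 0 ≤ s ∧ s ≤ t ∧ t ≤ R := by
    intro x s t
    simp only [K, Set.mem_inter_iff, Set.mem_prod, Metric.mem_closedBall, dist_zero_right,
      Set.mem_Icc, Set.mem_ofPred_eq]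
    constructor
    · rintro ⟨⟨h1, ⟨h2, h3⟩, h4, h5⟩, h6⟩
      exact ⟨h1, h2, h6, h5⟩
    · rintro ⟨h1, h2, h3, h4⟩
      exact ⟨⟨h1, ⟨h2, h3.trans h4⟩, h2.trans h3, h4⟩, h3⟩
  have hK : IsCompact K :=
    ((isCompact_closedBall _ _).prod (isCompact_Icc.prod isCompact_Icc)).inter_right
      (isClosed_le (by fun_prop) (by fun_prop))
  have hFc : ContinuousOn (fun q : EuclideanSpace ℝ (Fin n) × ℝ × ℝ =>
      g (q.1, q.2.2) - g (q.1, q.2.1)) K := by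
    refine ContinuousOn.sub ?_ ?_
    · refine hcont.comp (f := fun q : EuclideanSpace ℝ (Fin n) × ℝ × ℝ => (q.1, q.2.2))
        (by fun_prop) ?_
      rintro ⟨x, s, t⟩ hq
      obtain ⟨-, h1, h2, -⟩ := (hKmem _ _ _).1 hq
      exact h1.trans h2
    · refine hcont.comp (f := fun q : EuclideanSpace ℝ (Fin n) × ℝ × ℝ => (q.1, q.2.1))
        (by fun_prop) ?_
      rintro ⟨x, s, t⟩ hq
      exact ((hKmem _ _ _).1 hq).2.1
  have hmem : (x, y₁, y₂) ∈ K := (hKmem _ _ _).2 ⟨hx, h0, h12, h2R⟩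
  obtain ⟨⟨z, s, t⟩, hq, hmin⟩ := hK.exists_isMinOn ⟨_, hmem⟩ hFc
  by_contra! hneg
  obtain ⟨hz, hs0, hst, htR⟩ := (hKmem _ _ _).1 hq
  have hmin' : ∀ z' s' t', ‖z'‖ ≤ R → 0 ≤ s' → s' ≤ t' → t' ≤ R →
      g (z, t) - g (z, s) ≤ g (z', t') - g (z', s') := fun z' s' t' a1 a2 a3 a4 =>
    hmin ((hKmem z' s' t').2 ⟨a1, a2, a3, a4⟩)
  have hFneg : g (z, t) - g (z, s) < 0 := by
    linarith [hmin' x y₁ y₂ hx h0 h12 h2R]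
  have hst' : s < t := lt_of_le_of_ne hst (by rintro rfl; simp at hFneg)
  -- Positive flux makes g increase just above y = 0, so lifting s off 0 would lower the difference
  -- below its minimum.
  have hs : 0 < s := by
    refine lt_of_le_of_ne hs0 ?_
    rintro rfl
    obtain ⟨η, hη, hη'⟩ := (mem_nhdsGT_iff_exists_Ioo_subset' hst').1
      (inter_mem (hflux z) (Ioo_mem_nhdsGT hst'))
    have hη0 : (0 : ℝ) < η := hη
    have hmono : StrictMonoOn (fun τ : ℝ => g (z, τ)) (Set.Icc 0 (η / 2)) := by
      refine strictMonoOn_of_deriv_pos (convex_Icc _ _)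
        ((continuousOn_slice hcont z).mono Set.Icc_subset_Ici_self) fun τ hτ => ?_
      rw [interior_Icc] at hτ
      rw [(H.y1 z τ hτ.1).deriv]
      exact (hη' ⟨hτ.1, by linarith [hτ.2]⟩).1
    have h1 : g (z, 0) < g (z, η / 2) :=
      hmono (by constructor <;> linarith) (by constructor <;> linarith) (by linarith)
    have h2 : η / 2 < t := (hη' ⟨by linarith, by linarith⟩).2.2
    linarith [hmin' z (η / 2) t hz (by linarith) h2.le htR]
  have hzR : ‖z‖ < R := lt_of_le_of_ne hz fun h => by
    linarith [hside z s t h hs hst' htR]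
  have htR' : t < R := lt_of_le_of_ne htR fun h => by
    subst h
    linarith [htop z s hz hs hst']
  have ht : 0 < t := hs.trans hst'
  have hminT : IsLocalMin (fun τ : ℝ => g (z, τ)) t := by
    filter_upwards [Ioo_mem_nhds hst' htR'] with τ hτ
    linarith [hmin' z s τ hz hs.le hτ.1.le hτ.2.le]
  have hminS : IsLocalMin (fun τ : ℝ => -g (z, τ)) s := by
    filter_upwards [Ioo_mem_nhds hs hst'] with τ hτ
    linarith [hmin' z τ t hz hτ.1.le hτ.2.le htR]
  -- At the interior minimum both vertical derivatives vanish, so the different drift coefficients a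
  -- / t and a / s drop out. The second-order conditions then order the operator values at s and t
  -- against `hop`.
  have hT1 : gy (z, t) = 0 := hminT.hasDerivAt_eq_zero (H.y1 z t ht)
  have hS1 : gy (z, s) = 0 := neg_eq_zero.1 (hminS.hasDerivAt_eq_zero (H.y1 z s hs).neg)
  have hT2 : 0 ≤ gyy (z, t) := hminT.second_deriv_nonneg
    ((eventually_gt_nhds ht).mono fun τ hτ => H.y1 z τ hτ) (H.y2 z t ht)
  have hS2 : 0 ≤ -gyy (z, s) := hminS.second_deriv_nonneg (f' := fun τ => -gy (z, τ))
    ((eventually_gt_nhds hs).mono fun τ hτ => (H.y1 z τ hτ).neg) (H.y2 z s hs).neg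
  have hX : ∀ i, gxx i (z, s) ≤ gxx i (z, t) := by
    intro i
    have hm : IsLocalMin (fun τ : ℝ => g (z + τ • EuclideanSpace.single i 1, t)
        - g (z + τ • EuclideanSpace.single i 1, s)) 0 := by
      have hev : ∀ᶠ τ : ℝ in 𝓝 0, ‖z + τ • EuclideanSpace.single i (1 : ℝ)‖ < R := by
        refine ContinuousAt.eventually_lt (by fun_prop) continuousAt_const ?_
        simpa using hzR
      filter_upwards [hev] with τ hτ
      simpa using hmin' _ s t hτ.le hs.le hst htR
    have h2 := hm.second_deriv_nonneg
      (Eventually.of_forall fun τ => (H.x1 i z t ht τ).sub (H.x1 i z s hs τ))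
      ((H.x2 i z t ht 0).sub (H.x2 i z s hs 0))
    simp only [zero_smul, add_zero] at h2
    linarith
  have hlt := hop z s t hs hst'
  rw [hT1, hS1] at hlt
  have hsum := Finset.sum_le_sum fun i (_ : i ∈ Finset.univ) => hX i
  linarith

/-! ### Power barrier and almost-monotonicity on a cylinder -/

theorem hasPurePartials_barrier (n : ℕ) (α β γ δ b : ℝ) :
    HasPurePartials (n := n)
      (fun p => (α * ‖p.1‖ ^ 2 + δ) * p.2 ^ b + β * p.2 ^ 2 - γ * p.2 ^ (b + 2))
      (fun p => (α * ‖p.1‖ ^ 2 + δ) * (b * p.2 ^ (b - 1)) + β * (2 * p.2)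
        - γ * ((b + 2) * p.2 ^ (b + 1)))
      (fun p => (α * ‖p.1‖ ^ 2 + δ) * (b * ((b - 1) * p.2 ^ (b - 2))) + β * 2
        - γ * ((b + 2) * ((b + 1) * p.2 ^ b)))
      (fun i p => α * (2 * p.1 i) * p.2 ^ b)
      (fun _ p => α * 2 * p.2 ^ b) where
  y1 x y hy := by
    have h1 := Real.hasDerivAt_rpow_const (p := b) (Or.inl hy.ne')
    have h2 := Real.hasDerivAt_rpow_const (p := b + 2) (Or.inl hy.ne')
    rw [show b + 2 - 1 = b + 1 by ring] at h2
    have h3 : HasDerivAt (fun t : ℝ => t ^ 2) (2 * y) y := by simpa using hasDerivAt_pow 2 y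
    exact ((h1.const_mul (α * ‖x‖ ^ 2 + δ)).add (h3.const_mul β)).sub (h2.const_mul γ)
  y2 x y hy := by
    have h1 := Real.hasDerivAt_rpow_const (p := b - 1) (Or.inl hy.ne')
    have h2 := Real.hasDerivAt_rpow_const (p := b + 1) (Or.inl hy.ne')
    rw [show b + 1 - 1 = b by ring] at h2
    rw [show b - 1 - 1 = b - 2 by ring] at h1
    have h3 : HasDerivAt (fun t : ℝ => 2 * t) 2 y := by
      simpa using (hasDerivAt_id y).const_mul 2
    exact (((h1.const_mul b).const_mul (α * ‖x‖ ^ 2 + δ)).add (h3.const_mul β)).sub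
      ((h2.const_mul (b + 2)).const_mul γ)
  x1 i x y hy t := by
    have hn : ∀ t : ℝ, ‖x + t • EuclideanSpace.single i (1 : ℝ)‖ ^ 2 =
        ‖x‖ ^ 2 + 2 * (t * x i) + t ^ 2 := by
      intro t
      rw [norm_add_sq_real, inner_smul_right, norm_smul, mul_pow]
      simp [EuclideanSpace.inner_single_right]
    have h1 : HasDerivAt (fun t : ℝ => ‖x‖ ^ 2 + 2 * (t * x i) + t ^ 2) (2 * (x i + t)) t := by
      have := ((((hasDerivAt_id t).mul_const (x i)).const_mul 2).const_add (‖x‖ ^ 2)).add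
        (hasDerivAt_pow 2 t)
      refine this.congr_deriv ?_
      norm_num; ring
    simp only [hn]
    refine (((((h1.const_mul α).add_const δ).mul_const (y ^ b)).add_const (β * y ^ 2)).sub_const
      (γ * y ^ (b + 2))).congr_deriv ?_
    simp
  x2 i x y hy t := by
    have h1 : HasDerivAt (fun t : ℝ => x i + t) 1 t := (hasDerivAt_id t).const_add _
    have h2 := ((h1.const_mul 2).const_mul α).mul_const (y ^ b)
    rw [mul_one] at h2
    simpa using h2

/-- The vertical operator annihilates y^b and sends y² to a constant, so all dependence on y comes
from α‖x‖² y^b and γ y^(b + 2). A large enough γ makes the result strictly decreasing in y. -/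
theorem barrier_op_eq (n : ℕ) (α β γ δ b r y : ℝ) (hy : 0 < y) :
    ∑ _i : Fin n, α * 2 * y ^ b + ((α * r + δ) * (b * ((b - 1) * y ^ (b - 2))) + β * 2
        - γ * ((b + 2) * ((b + 1) * y ^ b))) +
      (1 - b) / y * ((α * r + δ) * (b * y ^ (b - 1)) + β * (2 * y)
        - γ * ((b + 2) * y ^ (b + 1))) =
      2 * (n * α - γ * (b + 2)) * y ^ b + 2 * β * (2 - b) := by
  have h1 : y ^ (b - 2) = y ^ b / y ^ 2 := by
    rw [Real.rpow_sub hy]; norm_num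
  rw [h1, Real.rpow_sub_one hy.ne', Real.rpow_add_one hy.ne']
  simp only [Finset.sum_const, Finset.card_univ, Fintype.card_fin, nsmul_eq_mul]
  field_simp
  ring

/-- Holds because (b + 2) y^b ≤ 4 R^b on (0, R]. It lets the y² term of the barrier absorb the
negative y^(b + 2) term. -/
theorem rpow_add_two_sub_le {b R y₁ y₂ : ℝ} (hb0 : 0 < b) (hb2 : b < 2) (h1 : 0 < y₁)
    (h12 : y₁ ≤ y₂) (h2 : y₂ ≤ R) :
    y₂ ^ (b + 2) - y₁ ^ (b + 2) ≤ 2 * R ^ b * (y₂ ^ 2 - y₁ ^ 2) := by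
  have hd : ∀ y : ℝ, 0 < y → HasDerivAt (fun t : ℝ => 2 * R ^ b * t ^ 2 - t ^ (b + 2))
      (2 * R ^ b * (2 * y) - (b + 2) * (y ^ b * y)) y := by
    intro y hy
    have h1 := Real.hasDerivAt_rpow_const (p := b + 2) (Or.inl hy.ne')
    rw [show b + 2 - 1 = b + 1 by ring, Real.rpow_add_one hy.ne'] at h1
    have h3 : HasDerivAt (fun t : ℝ => t ^ 2) (2 * y) y := by simpa using hasDerivAt_pow 2 y
    exact (h3.const_mul _).sub h1
  have hm : MonotoneOn (fun t : ℝ => 2 * R ^ b * t ^ 2 - t ^ (b + 2)) (Set.Icc y₁ R) := by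
    refine monotoneOn_of_deriv_nonneg (convex_Icc _ _)
      (fun y hy => (hd y (h1.trans_le hy.1)).continuousAt.continuousWithinAt)
      (fun y hy => ?_) fun y hy => ?_ <;> rw [interior_Icc] at hy
    · exact (hd y (h1.trans hy.1)).differentiableAt.differentiableWithinAt
    · have hy0 : 0 < y := h1.trans hy.1
      rw [(hd y hy0).deriv]
      have h4 : y ^ b ≤ R ^ b := Real.rpow_le_rpow hy0.le hy.2.le hb0.le
      have h5 : 0 < y ^ b := Real.rpow_pos_of_pos hy0 b
      have : 0 ≤ y * (4 * R ^ b - (b + 2) * y ^ b) := by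
        apply mul_nonneg hy0.le; nlinarith
      linarith
  have := hm ⟨le_rfl, h12.trans h2⟩ ⟨h12, h2⟩ h12
  simp only at this
  linarith

/-- A function whose weighted derivative `t ^ (1 - b) * f' t` is nonincreasing is concave in the
variable `t ^ b`, so its slopes on `(0, R]` are at least its slope on `[R, 2R]`. -/
theorem slope_le_of_antitone_weighted {f f' : ℝ → ℝ} {b R y₁ y₂ : ℝ} (hb : 0 < b)
    (hf : ∀ t, 0 < t → HasDerivAt f (f' t) t)
    (hw : ∀ s t, 0 < s → s ≤ t → t ^ (1 - b) * f' t ≤ s ^ (1 - b) * f' s)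
    (h1 : 0 < y₁) (h12 : y₁ ≤ y₂) (h2 : y₂ ≤ R) :
    (f (2 * R) - f R) / ((2 * R) ^ b - R ^ b) * (y₂ ^ b - y₁ ^ b) ≤ f y₂ - f y₁ := by
  have hR : 0 < R := h1.trans_le (h12.trans h2)
  -- w / b is the slope of f in the variable t^b at t = R; subtracting this tangent leaves a
  -- function increasing before R and decreasing after it.
  set w : ℝ := R ^ (1 - b) * f' R with hwR
  have hd : ∀ t : ℝ, 0 < t → HasDerivAt (fun t => f t - w / b * t ^ b)
      (t ^ (b - 1) * (t ^ (1 - b) * f' t - w)) t := by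
    intro t ht
    refine ((hf t ht).sub ((Real.hasDerivAt_rpow_const (p := b)
      (Or.inl ht.ne')).const_mul (w / b))).congr_deriv ?_
    have : t ^ (b - 1) * t ^ (1 - b) = 1 := by rw [← Real.rpow_add ht]; simp
    field_simp
    linear_combination (-(f' t)) * this
  have hcont : ∀ t : ℝ, 0 < t → ContinuousAt (fun t => f t - w / b * t ^ b) t :=
    fun t ht => (hd t ht).continuousAt
  have hlow : MonotoneOn (fun t => f t - w / b * t ^ b) (Set.Icc y₁ R) := by
    refine monotoneOn_of_deriv_nonneg (convex_Icc _ _)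
      (fun y hy => (hcont y (h1.trans_le hy.1)).continuousWithinAt)
      (fun y hy => ?_) fun y hy => ?_ <;> rw [interior_Icc] at hy
    · exact (hd y (h1.trans hy.1)).differentiableAt.differentiableWithinAt
    · have hy0 : 0 < y := h1.trans hy.1
      rw [(hd y hy0).deriv]
      exact mul_nonneg (Real.rpow_nonneg hy0.le _) (sub_nonneg.2 (hw y R hy0 hy.2.le))
  have hhigh : AntitoneOn (fun t => f t - w / b * t ^ b) (Set.Icc R (2 * R)) := by
    refine antitoneOn_of_deriv_nonpos (convex_Icc _ _)
      (fun y hy => (hcont y (hR.trans_le hy.1)).continuousWithinAt)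
      (fun y hy => ?_) fun y hy => ?_ <;> rw [interior_Icc] at hy
    · exact (hd y (hR.trans hy.1)).differentiableAt.differentiableWithinAt
    · have hy0 : 0 < y := hR.trans hy.1
      rw [(hd y hy0).deriv]
      exact mul_nonpos_of_nonneg_of_nonpos (Real.rpow_nonneg hy0.le _)
        (sub_nonpos.2 (hw R y hR hy.1.le))
  have e1 := hlow ⟨le_rfl, h12.trans h2⟩ ⟨h12, h2⟩ h12
  have e2 := hhigh ⟨le_rfl, by linarith⟩ ⟨by linarith, le_rfl⟩ (by linarith : R ≤ 2 * R)
  simp only at e1 e2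
  have hden : 0 < (2 * R) ^ b - R ^ b :=
    sub_pos.2 (Real.rpow_lt_rpow hR.le (by linarith) hb)
  have hnum : 0 ≤ y₂ ^ b - y₁ ^ b := sub_nonneg.2 (Real.rpow_le_rpow h1.le h12 hb.le)
  calc (f (2 * R) - f R) / ((2 * R) ^ b - R ^ b) * (y₂ ^ b - y₁ ^ b)
      ≤ w / b * (y₂ ^ b - y₁ ^ b) := by
        apply mul_le_mul_of_nonneg_right _ hnum
        rw [div_le_iff₀ hden]; linarith
    _ ≤ f y₂ - f y₁ := by linarith

theorem HasPurePartials.sub_le_of_slope_bound {n : ℕ} {u uy uyy : ExtSpace n → ℝ}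
    {ux uxx : Fin n → ExtSpace n → ℝ} (H : HasPurePartials u uy uyy ux uxx) {b k R : ℝ}
    (hb0 : 0 < b) (hb2 : b < 2) (hk : 0 < k) (hR : 0 < R)
    (hcont : ContinuousOn u (closedHalf n))
    (heq : ∀ x y, 0 < y → ∑ i, uxx i (x, y) + uyy (x, y) + (1 - b) / y * uy (x, y) = 0)
    (hflux : ∀ x, ∀ η > 0, ∀ᶠ y in 𝓝[>] (0 : ℝ), -η < y ^ (1 - b) * uy (x, y))
    (hslope : ∀ x y₁ y₂, ‖x‖ ≤ R → 0 < y₁ → y₁ < y₂ → y₂ ≤ R →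
      -(k * (y₂ ^ b - y₁ ^ b)) ≤ u (x, y₂) - u (x, y₁))
    {x : EuclideanSpace ℝ (Fin n)} {y₁ y₂ : ℝ} (hx : ‖x‖ ≤ R) (h1 : 0 < y₁) (h12 : y₁ ≤ y₂)
    (h2R : y₂ ≤ R) :
    u (x, y₁) - u (x, y₂) ≤ k / R ^ 2 * ‖x‖ ^ 2 * (y₂ ^ b - y₁ ^ b) +
      (2 * n + 3) * k * R ^ (b - 2) * (y₂ ^ 2 - y₁ ^ 2) := by
  set ρ := R ^ (b - 2) with hρ
  have hρ0 : 0 < ρ := Real.rpow_pos_of_pos hR _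
  have hρR : R ^ b = ρ * R ^ 2 := by
    rw [hρ, Real.rpow_sub hR]; norm_num; field_simp
  have hpow : ∀ s t : ℝ, 0 < s → s ≤ t → s ^ b ≤ t ^ b := fun s t hs hst =>
    Real.rpow_le_rpow hs.le hst hb0.le
  have hdiff : ∀ s t : ℝ, 0 < s → s ≤ t → t ≤ R →
      k * (n + 1) / R ^ 2 * (t ^ (b + 2) - s ^ (b + 2)) ≤
        2 * (n + 1) * k * ρ * (t ^ 2 - s ^ 2) := by
    intro s t hs hst ht
    have := mul_le_mul_of_nonneg_left (rpow_add_two_sub_le hb0 hb2 hs hst ht)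
      (by positivity : 0 ≤ k * (n + 1) / R ^ 2)
    refine this.trans_eq ?_
    rw [hρR]
    field_simp
  -- The term δ y^b upgrades the nonnegative flux to a strictly positive one; δ is sent to 0 at the
  -- end.
  have main : ∀ δ > 0, u (x, y₁) - u (x, y₂) ≤
      (k / R ^ 2 * ‖x‖ ^ 2 * (y₂ ^ b - y₁ ^ b) +
      (2 * n + 3) * k * ρ * (y₂ ^ 2 - y₁ ^ 2)) + δ * (y₂ ^ b - y₁ ^ b) := by
    intro δ hδ
    -- α = k / R² cancels the slope bound on ‖x‖ = R. γ = k(n + 1) / R² exceeds nα / (b + 2), as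
    -- strict decrease requires. In β, the share 2(n + 1) absorbs γ through `hdiff`, and the
    -- remaining 1 beats the slope bound at the top, where k(R^b - s^b) ≤ kρ(R² - s²).
    have HG := H.add (hasPurePartials_barrier n (k / R ^ 2) ((2 * n + 3) * k * ρ)
      (k * (n + 1) / R ^ 2) δ b)
    have key := HG.mono_of_strictAnti_op (a := 1 - b) (R := R) ?_ ?_ ?_ ?_ ?_ hx h1.le h12 h2R
    · simp only [Pi.add_apply] at key
      have hlast : 0 ≤ k * (n + 1) / R ^ 2 * (y₂ ^ (b + 2) - y₁ ^ (b + 2)) :=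
        mul_nonneg (by positivity)
          (sub_nonneg.2 (Real.rpow_le_rpow h1.le h12 (by linarith)))
      linarith
    · refine hcont.add (Continuous.continuousOn ?_)
      have c1 : Continuous fun t : ℝ => t ^ b := Real.continuous_rpow_const hb0.le
      have c2 : Continuous fun t : ℝ => t ^ (b + 2) := Real.continuous_rpow_const (by linarith)
      have c1' : Continuous fun p : ExtSpace n => p.2 ^ b := c1.comp continuous_snd
      have c2' : Continuous fun p : ExtSpace n => p.2 ^ (b + 2) := c2.comp continuous_snd
      fun_prop
    · intro z s t hs hst
      have hval : ∀ y : ℝ, 0 < y → _ = _ := fun y hy => barrier_op_eq n (k / R ^ 2)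
        ((2 * n + 3) * k * ρ) (k * (n + 1) / R ^ 2) δ b (‖z‖ ^ 2) y hy
      have e1 := hval s hs
      have e2 := hval t (hs.trans hst)
      have e3 := heq z s hs
      have e4 := heq z t (hs.trans hst)
      simp only [Pi.add_apply, Finset.sum_add_distrib]
      have hlt : s ^ b < t ^ b := Real.rpow_lt_rpow hs.le hst hb0
      have hcoef : 2 * (n * (k / R ^ 2) - k * (n + 1) / R ^ 2 * (b + 2)) < 0 := by
        have : 2 * (n * (k / R ^ 2) - k * (n + 1) / R ^ 2 * (b + 2)) =
          -(2 * (k / R ^ 2) * ((n + 1) * (b + 1) + 1)) := by ring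
        rw [this]
        have : 0 < 2 * (k / R ^ 2) * ((n + 1) * (b + 1) + 1) := by positivity
        linarith
      have := mul_lt_mul_of_neg_left hlt hcoef
      linarith
    · intro z
      have hsmall : ∀ᶠ y in 𝓝[>] (0 : ℝ),
          k * (n + 1) / R ^ 2 * ((b + 2) * y ^ 2) < δ * b / 2 := by
        have : Tendsto (fun y : ℝ => k * (n + 1) / R ^ 2 * ((b + 2) * y ^ 2)) (𝓝[>] 0)
            (𝓝 (k * (n + 1) / R ^ 2 * ((b + 2) * 0 ^ 2))) :=
          (Continuous.tendsto (by fun_prop) 0).mono_left nhdsWithin_le_nhds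
        refine this.eventually_lt_const ?_
        have : 0 < δ * b / 2 := by positivity
        simpa using this
      filter_upwards [hsmall, hflux z (δ * b / 2) (by positivity), self_mem_nhdsWithin]
        with y hy1 hy2 hy0
      replace hy0 : 0 < y := hy0
      simp only [Pi.add_apply]
      have hp : 0 < y ^ (1 - b) := Real.rpow_pos_of_pos hy0 _
      refine pos_of_mul_pos_right (b := _) (a := y ^ (1 - b)) ?_ hp.le
      have i1 : y ^ (1 - b) * y ^ (b - 1) = 1 := by rw [← Real.rpow_add hy0]; simp
      have i2 : y ^ (1 - b) * y ^ (b + 1) = y ^ 2 := by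
        rw [← Real.rpow_add hy0, show 1 - b + (b + 1) = ((2 : ℕ) : ℝ) by push_cast; ring,
          Real.rpow_natCast]
      have e : y ^ (1 - b) * (uy (z, y) + ((k / R ^ 2 * ‖z‖ ^ 2 + δ) * (b * y ^ (b - 1)) +
          (2 * n + 3) * k * ρ * (2 * y) - k * (n + 1) / R ^ 2 * ((b + 2) * y ^ (b + 1)))) =
          y ^ (1 - b) * uy (z, y) + δ * b - k * (n + 1) / R ^ 2 * ((b + 2) * y ^ 2) +
          (k / R ^ 2 * ‖z‖ ^ 2 * b + y ^ (1 - b) * ((2 * n + 3) * k * ρ * (2 * y))) := by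
        linear_combination (k / R ^ 2 * ‖z‖ ^ 2 + δ) * b * i1
          - k * (n + 1) / R ^ 2 * (b + 2) * i2
      rw [e]
      have : 0 ≤ k / R ^ 2 * ‖z‖ ^ 2 * b + y ^ (1 - b) * ((2 * n + 3) * k * ρ * (2 * y)) := by
        positivity
      linarith
    · intro z s t hz hs hst ht
      simp only [Pi.add_apply, hz]
      have e1 := hslope z s t hz.le hs hst ht
      have e2 := hdiff s t hs hst.le ht
      have e3 : k / R ^ 2 * R ^ 2 = k := by field_simp
      have e4 := mul_nonneg hδ.le (sub_nonneg.2 (hpow s t hs hst.le))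
      have e5 : 0 ≤ k * ρ * (t ^ 2 - s ^ 2) :=
        mul_nonneg (by positivity) (by nlinarith)
      rw [e3]
      linarith
    · intro z s hz hs hsR
      simp only [Pi.add_apply]
      have e1 := hslope z s R hz hs hsR le_rfl
      have e2 := hdiff s R hs hsR.le le_rfl
      have e3 := mul_nonneg (by positivity : 0 ≤ k / R ^ 2 * ‖z‖ ^ 2 + δ)
        (sub_nonneg.2 (hpow s R hs hsR.le))
      have e4 : ρ * s ^ 2 ≤ s ^ b := by
        have h : s ^ b = s ^ (b - 2) * s ^ 2 := by
          rw [Real.rpow_sub hs]; norm_num; field_simp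
        rw [h]
        exact mul_le_mul_of_nonneg_right
          (Real.rpow_le_rpow_of_nonpos hs hsR.le (by linarith)) (sq_nonneg s)
      have e5 : k * (R ^ b - s ^ b) ≤ k * ρ * (R ^ 2 - s ^ 2) := by
        rw [hρR]
        have := mul_le_mul_of_nonneg_left e4 hk.le
        linarith
      linarith
  have hlim : Tendsto (fun δ : ℝ => (k / R ^ 2 * ‖x‖ ^ 2 * (y₂ ^ b - y₁ ^ b) +
      (2 * n + 3) * k * ρ * (y₂ ^ 2 - y₁ ^ 2)) + δ * (y₂ ^ b - y₁ ^ b)) (𝓝[>] 0)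
      (𝓝 ((k / R ^ 2 * ‖x‖ ^ 2 * (y₂ ^ b - y₁ ^ b) +
      (2 * n + 3) * k * ρ * (y₂ ^ 2 - y₁ ^ 2)) + 0 * (y₂ ^ b - y₁ ^ b))) :=
    (Continuous.tendsto (by fun_prop) 0).mono_left nhdsWithin_le_nhds
  rw [zero_mul, add_zero] at hlim
  exact ge_of_tendsto hlim (eventually_mem_nhdsWithin.mono fun δ hδ => main δ hδ)

/-! ### Strong maximum principle by a Gaussian barrier -/

theorem hasPurePartials_gaussian {n : ℕ} (z : EuclideanSpace ℝ (Fin n)) (Y α c : ℝ) :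
    HasPurePartials (n := n)
      (fun p => c * Real.exp (-α * (‖p.1 - z‖ ^ 2 + (p.2 - Y) ^ 2)))
      (fun p => c * (-(2 * α * (p.2 - Y)) * Real.exp (-α * (‖p.1 - z‖ ^ 2 + (p.2 - Y) ^ 2))))
      (fun p => c * ((4 * α ^ 2 * (p.2 - Y) ^ 2 - 2 * α) *
        Real.exp (-α * (‖p.1 - z‖ ^ 2 + (p.2 - Y) ^ 2))))
      (fun i p => c * (-(2 * α * (p.1 i - z i)) *
        Real.exp (-α * (‖p.1 - z‖ ^ 2 + (p.2 - Y) ^ 2))))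
      (fun i p => c * ((4 * α ^ 2 * (p.1 i - z i) ^ 2 - 2 * α) *
        Real.exp (-α * (‖p.1 - z‖ ^ 2 + (p.2 - Y) ^ 2)))) := by
  have he : ∀ A B t : ℝ, HasDerivAt (fun t : ℝ => Real.exp (-α * (A + (B + t) ^ 2)))
      (-(2 * α * (B + t)) * Real.exp (-α * (A + (B + t) ^ 2))) t := by
    intro A B t
    have h1 : HasDerivAt (fun t : ℝ => -α * (A + (B + t) ^ 2)) (-(2 * α * (B + t))) t := by
      refine ((((((hasDerivAt_id t).const_add B).pow 2).const_add A).const_mul (-α))).congr_deriv ?_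
      simp; ring
    exact h1.exp.congr_deriv (by ring)
  have he' : ∀ A B t : ℝ, HasDerivAt
      (fun t : ℝ => -(2 * α * (B + t)) * Real.exp (-α * (A + (B + t) ^ 2)))
      ((4 * α ^ 2 * (B + t) ^ 2 - 2 * α) * Real.exp (-α * (A + (B + t) ^ 2))) t := by
    intro A B t
    have h1 : HasDerivAt (fun t : ℝ => -(2 * α * (B + t))) (-(2 * α)) t := by
      refine ((((hasDerivAt_id t).const_add B).const_mul (2 * α)).neg).congr_deriv ?_
      simp
    exact (h1.mul (he A B t)).congr_deriv (by ring)
  have hn : ∀ (x : EuclideanSpace ℝ (Fin n)) (i : Fin n) (y t : ℝ),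
      ‖x + t • EuclideanSpace.single i (1 : ℝ) - z‖ ^ 2 + (y - Y) ^ 2 =
      (‖x - z‖ ^ 2 - (x i - z i) ^ 2 + (y - Y) ^ 2) + ((x i - z i) + t) ^ 2 := by
    intro x i y t
    rw [add_sub_right_comm, norm_add_sq_real, inner_smul_right, norm_smul, mul_pow]
    simp [EuclideanSpace.inner_single_right]
    ring
  have hi : ∀ (x : EuclideanSpace ℝ (Fin n)) (i : Fin n) (t : ℝ),
      (x + t • EuclideanSpace.single i (1 : ℝ)) i - z i = (x i - z i) + t := by
    intro x i t; simp; ring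
  constructor
  · intro x y hy
    have := (he (‖x - z‖ ^ 2) (-Y) y).const_mul c
    simpa only [neg_add_eq_sub] using this
  · intro x y hy
    have := (he' (‖x - z‖ ^ 2) (-Y) y).const_mul c
    simpa only [neg_add_eq_sub] using this
  · intro i x y hy t
    simp only [hn, hi]
    exact (he _ _ t).const_mul c
  · intro i x y hy t
    simp only [hn, hi]
    exact (he' _ _ t).const_mul c

/-- A quantitative strong maximum principle: positivity of a nonnegative solution at `(z, Y)`
spreads to the points `(x, Y)` with `‖x - z‖ ≤ Y / 2`. -/
theorem HasPurePartials.pos_of_pos {n : ℕ} {u uy uyy : ExtSpace n → ℝ}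
    {ux uxx : Fin n → ExtSpace n → ℝ} (H : HasPurePartials u uy uyy ux uxx) {a Y : ℝ}
    (ha : |a| ≤ 1) (hcont : ContinuousOn u (openHalf n))
    (heq : ∀ x y, 0 < y → ∑ i, uxx i (x, y) + uyy (x, y) + a / y * uy (x, y) = 0)
    (hnn : ∀ p ∈ openHalf n, 0 ≤ u p) (hY : 0 < Y) {z x : EuclideanSpace ℝ (Fin n)}
    (hz : 0 < u (z, Y)) (hx : ‖x - z‖ ≤ Y / 2) : 0 < u (x, Y) := by
  obtain ⟨r, hr, hball⟩ : ∃ r > 0, ∀ p : ExtSpace n, dist p (z, Y) < r → u (z, Y) / 2 < u p := by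
    have h1 : ContinuousAt u (z, Y) :=
      hcont.continuousAt ((isOpen_openHalf n).mem_nhds hY)
    exact Metric.eventually_nhds_iff.1
      (h1.eventually (lt_mem_nhds (by linarith : u (z, Y) / 2 < u (z, Y))))
  set m := u (z, Y) / 2 with hm
  have hm0 : 0 < m := by positivity
  -- Outside the ball where u > m this gives αρ ≥ n + 5, so 2αρ exceeds (n + 1) + 3, the dimensional
  -- term plus the bound on the drift.
  set α : ℝ := (n + 5) / r ^ 2 with hα
  have hα0 : 0 < α := by positivity
  -- More than Y / 2, so that (x, Y) is interior, and less than Y, so that heights stay above Y / 4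
  -- and the drift is bounded.
  set R : ℝ := 3 * Y / 4 with hRdef
  have hR : 0 < R := by positivity
  let ρ : ExtSpace n → ℝ := fun p => ‖p.1 - z‖ ^ 2 + (p.2 - Y) ^ 2
  have hρc : Continuous ρ := by fun_prop
  let D : Set (ExtSpace n) := {p | ρ p ≤ R ^ 2}
  have hDsub : D ⊆ Metric.closedBall z R ×ˢ Set.Icc (Y / 4) (7 * Y / 4) := by
    intro p hp
    have hp' : ‖p.1 - z‖ ^ 2 + (p.2 - Y) ^ 2 ≤ R ^ 2 := hp
    have h1 : ‖p.1 - z‖ ≤ R :=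
      abs_le_of_sq_le_sq' (by nlinarith [sq_nonneg (p.2 - Y)]) hR.le |>.2
    have h2 := abs_le_of_sq_le_sq' (by nlinarith [sq_nonneg ‖p.1 - z‖] :
      (p.2 - Y) ^ 2 ≤ R ^ 2) hR.le
    refine ⟨by rwa [Metric.mem_closedBall, dist_eq_norm], ?_, ?_⟩ <;> linarith [h2.1, h2.2]
  have hDpos : ∀ p ∈ D, p ∈ openHalf n := fun p hp =>
    lt_of_lt_of_le (by positivity) (hDsub hp).2.1
  have hD : IsCompact D :=
    ((isCompact_closedBall _ _).prod isCompact_Icc).of_isClosed_subset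
      (isClosed_le hρc continuous_const) hDsub
  have HG := H.add (hasPurePartials_gaussian z Y α (-m))
  set g : ExtSpace n → ℝ := u + fun p => -m * Real.exp (-α * (‖p.1 - z‖ ^ 2 + (p.2 - Y) ^ 2))
    with hg
  have hgval : ∀ p, g p = u p - m * Real.exp (-α * ρ p) := fun p => by
    simp only [hg, Pi.add_apply, ρ]; ring
  have hgc : ContinuousOn g D :=
    (hcont.mono hDpos).add (Continuous.continuousOn (by fun_prop))
  set κ := m * Real.exp (-α * R ^ 2) with hκ
  have hκ0 : 0 < κ := by positivity
  have hxD : (x, Y) ∈ D := by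
    change ‖x - z‖ ^ 2 + (Y - Y) ^ 2 ≤ R ^ 2
    nlinarith [norm_nonneg (x - z)]
  have main : -κ ≤ g (x, Y) := by
    -- A minimum below -κ cannot lie on the sphere, where u ≥ 0 gives g ≥ -κ, nor near the centre,
    -- where u > m gives g > 0. In between, the barrier has the wrong sign under the operator.
    obtain ⟨⟨w, t⟩, hq, hmin⟩ := hD.exists_isMinOn ⟨_, hxD⟩ hgc
    by_contra! hneg
    have hlow : g (w, t) < -κ := (hmin hxD).trans_lt hneg
    have ht : 0 < t := hDpos _ hq
    have hin : ρ (w, t) < R ^ 2 := by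
      refine lt_of_le_of_ne hq fun h => ?_
      have := hnn _ (hDpos _ hq)
      rw [hgval, h] at hlow
      linarith
    have hout : r ^ 2 ≤ ρ (w, t) := by
      by_contra! h
      have h' : ‖w - z‖ ^ 2 + (t - Y) ^ 2 < r ^ 2 := h
      have h1 : ‖w - z‖ < r := abs_lt_of_sq_lt_sq' (by nlinarith [sq_nonneg (t - Y)]) hr.le |>.2
      have h2 : |t - Y| < r := abs_lt.2 <|
        abs_lt_of_sq_lt_sq' (by nlinarith [sq_nonneg ‖w - z‖]) hr.le
      have h3 := hball (w, t) (by
        rw [Prod.dist_eq, dist_eq_norm, Real.dist_eq]; exact max_lt h1 h2)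
      have h4 : Real.exp (-α * ρ (w, t)) ≤ 1 := by
        rw [Real.exp_le_one_iff]
        have : 0 ≤ ρ (w, t) := by positivity
        nlinarith
      rw [hgval] at hlow
      nlinarith
    have hloc : IsLocalMin g (w, t) := by
      filter_upwards [(hρc.tendsto (w, t)).eventually_lt_const hin] with p hp
      exact hmin hp.le
    have hlocY : IsLocalMin (fun τ : ℝ => g (w, τ)) t := by
      have : Tendsto (fun τ : ℝ => ((w, τ) : ExtSpace n)) (𝓝 t) (𝓝 (w, t)) :=
        (Continuous.prodMk_right w).tendsto t
      exact this.eventually hloc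
    have hY1 := hlocY.hasDerivAt_eq_zero (HG.y1 w t ht)
    have hY2 := hlocY.second_deriv_nonneg
      ((eventually_gt_nhds ht).mono fun τ hτ => HG.y1 w τ hτ) (HG.y2 w t ht)
    have hX : ∀ i, 0 ≤ uxx i (w, t) + -m * ((4 * α ^ 2 * (w i - z i) ^ 2 - 2 * α) *
        Real.exp (-α * ρ (w, t))) := by
      intro i
      have hl : IsLocalMin
          (fun τ : ℝ => g (w + τ • EuclideanSpace.single i 1, t)) 0 := by
        have hT : Tendsto (fun τ : ℝ => ((w + τ • EuclideanSpace.single i 1, t) : ExtSpace n))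
            (𝓝 0) (𝓝 (w, t)) := by
          have : Continuous fun τ : ℝ =>
            ((w + τ • EuclideanSpace.single i 1, t) : ExtSpace n) := by fun_prop
          simpa using this.tendsto 0
        filter_upwards [hT.eventually hloc] with τ hτ
        simpa using hτ
      have := hl.second_deriv_nonneg (Eventually.of_forall fun τ => HG.x1 i w t ht τ)
        (HG.x2 i w t ht 0)
      simpa [ρ] using this
    have hsum := Finset.sum_nonneg fun i (_ : i ∈ Finset.univ) => hX i
    simp only [Pi.add_apply] at hY1 hY2
    change uy (w, t) + -m * (-(2 * α * (t - Y)) * Real.exp (-α * ρ (w, t))) = 0 at hY1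
    change 0 ≤ uyy (w, t) + -m * ((4 * α ^ 2 * (t - Y) ^ 2 - 2 * α) *
      Real.exp (-α * ρ (w, t))) at hY2
    set E := Real.exp (-α * ρ (w, t)) with hE
    have hE0 : 0 < E := Real.exp_pos _
    have hsumeq : ∑ i, (uxx i (w, t) + -m * ((4 * α ^ 2 * (w i - z i) ^ 2 - 2 * α) * E)) =
        ∑ i, uxx i (w, t) - m * E * (4 * α ^ 2 * ‖w - z‖ ^ 2 - 2 * α * n) := by
      rw [EuclideanSpace.real_norm_sq_eq, Finset.sum_add_distrib, ← Finset.mul_sum,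
        ← Finset.sum_mul, Finset.sum_sub_distrib, ← Finset.mul_sum]
      simp
      ring
    rw [hsumeq] at hsum
    have h0 := heq w t ht
    have huy : uy (w, t) = -(m * E * (2 * α * (t - Y))) := by linarith
    rw [huy] at h0
    have hfin : m * E * (2 * α) * (2 * α * ρ (w, t) - (n + 1) - a * ((t - Y) / t)) ≤ 0 := by
      have : m * E * (2 * α) * (2 * α * ρ (w, t) - (n + 1) - a * ((t - Y) / t)) =
          m * E * (4 * α ^ 2 * ‖w - z‖ ^ 2 - 2 * α * n) +
          m * ((4 * α ^ 2 * (t - Y) ^ 2 - 2 * α) * E)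
          + a / t * -(m * E * (2 * α * (t - Y))) := by
        simp only [ρ]; ring
      rw [this]; linarith
    have hα2 : n + 5 ≤ α * ρ (w, t) := by
      calc (n + 5 : ℝ) = α * r ^ 2 := by rw [hα]; field_simp
        _ ≤ _ := mul_le_mul_of_nonneg_left hout hα0.le
    have hquot : a * ((t - Y) / t) ≤ 3 := by
      have hb := (hDsub hq).2
      simp only [Set.mem_Icc] at hb
      have h1 : |(t - Y) / t| ≤ 3 := by
        rw [abs_div, abs_of_pos ht, div_le_iff₀ ht, abs_le]
        constructor <;> linarith
      calc a * ((t - Y) / t) ≤ |a * ((t - Y) / t)| := le_abs_self _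
        _ = |a| * |(t - Y) / t| := abs_mul _ _
        _ ≤ 1 * 3 := mul_le_mul ha h1 (abs_nonneg _) zero_le_one
        _ = 3 := by norm_num
    have hn0 : (0 : ℝ) ≤ n := Nat.cast_nonneg n
    have : 0 < m * E * (2 * α) * (2 * α * ρ (w, t) - (n + 1) - a * ((t - Y) / t)) := by
      apply mul_pos (by positivity); linarith
    linarith
  have hexp : κ < m * Real.exp (-α * ρ (x, Y)) := by
    apply mul_lt_mul_of_pos_left _ hm0
    apply Real.exp_lt_exp.2
    have : ρ (x, Y) < R ^ 2 := by
      change ‖x - z‖ ^ 2 + (Y - Y) ^ 2 < R ^ 2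
      nlinarith [norm_nonneg (x - z)]
    nlinarith
  rw [hgval] at main
  linarith

/-! ### Concavity in y^b and the limit R → ∞ -/

/-- By the equation, the y-derivative of y^a ∂ᵧu is -y^a Δₓu, and Δₓu ≥ 0 by convexity. -/
theorem antitone_weightedDY {n : ℕ} {a : ℝ} {u : ExtSpace n → ℝ}
    (hC2 : ContDiffOn ℝ 2 u (openHalf n))
    (heq : ∀ x y, 0 < y →
      ∑ i, dX i (dX i u) (x, y) + dY (dY u) (x, y) + a / y * dY u (x, y) = 0)
    (hconv : ∀ p ∈ openHalf n, ∀ ξ : EuclideanSpace ℝ (Fin n), 0 ≤ hessX u p ξ ξ)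
    (x : EuclideanSpace ℝ (Fin n)) {s t : ℝ} (hs : 0 < s) (hst : s ≤ t) :
    weightedDY a u x t ≤ weightedDY a u x s := by
  have hd : ∀ y, 0 < y → HasDerivAt (weightedDY a u x)
      (-(y ^ a * ∑ i, dX i (dX i u) (x, y))) y := by
    intro y hy
    have h1 := (Real.hasDerivAt_rpow_const (p := a) (Or.inl hy.ne')).mul
      (hC2.hasPurePartials.y2 x y hy)
    refine h1.congr_deriv ?_
    rw [Real.rpow_sub_one hy.ne']
    linear_combination y ^ a * heq x y hy
  have hanti : AntitoneOn (weightedDY a u x) (Set.Ici s) := by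
    refine antitoneOn_of_deriv_nonpos (convex_Ici _)
      (fun y hy => (hd y (hs.trans_le hy)).continuousAt.continuousWithinAt)
      (fun y hy => ?_) fun y hy => ?_ <;> rw [interior_Ici] at hy
    · exact (hd y (hs.trans hy)).differentiableAt.differentiableWithinAt
    · have hy0 : 0 < y := hs.trans hy
      rw [(hd y hy0).deriv, neg_nonpos]
      refine mul_nonneg (Real.rpow_nonneg hy0.le _) (Finset.sum_nonneg fun i _ => ?_)
      rw [← hC2.hessX_single (p := (x, y)) hy0]
      exact hconv _ hy0 _
  exact hanti Set.self_mem_Ici hst hst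

/-- Subquadratic growth gives a lower bound for the slopes in the variable `y ^ b`. -/
theorem slope_bound_of_growth {n : ℕ} {u : ExtSpace n → ℝ} {b q C R : ℝ}
    (hC2 : ContDiffOn ℝ 2 u (openHalf n)) (hb : 0 < b) (hq0 : 0 ≤ q) (hq2 : q ≤ 2) (hC : 0 ≤ C)
    (hw : ∀ x s t, 0 < s → s ≤ t → weightedDY (1 - b) u x t ≤ weightedDY (1 - b) u x s)
    (hgrowth : ∀ p ∈ openHalf n, |u p| ≤ C * (1 + ‖p.1‖ + |p.2|) ^ q) (hR : 1 ≤ R)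
    {x : EuclideanSpace ℝ (Fin n)} {y₁ y₂ : ℝ} (hx : ‖x‖ ≤ R) (h1 : 0 < y₁) (h12 : y₁ ≤ y₂)
    (h2R : y₂ ≤ R) :
    -(32 * C / (2 ^ b - 1) * R ^ (q - b) * (y₂ ^ b - y₁ ^ b)) ≤ u (x, y₂) - u (x, y₁) := by
  have hR0 : 0 < R := by linarith
  -- Since R ≥ 1, the base 1 + ‖x‖ + |y| is at most 4R, and 4^q ≤ 16; the two endpoints R and 2R
  -- together produce 32.
  have hbd : ∀ y, 0 < y → y ≤ 2 * R → |u (x, y)| ≤ 16 * C * R ^ q := by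
    intro y hy hyR
    refine (hgrowth (x, y) hy).trans ?_
    have e1 : (1 + ‖x‖ + |y|) ^ q ≤ (4 * R) ^ q := by
      apply Real.rpow_le_rpow (by positivity) _ hq0
      rw [abs_of_pos hy]; linarith
    have e2 : (4 : ℝ) ^ q ≤ 16 := by
      calc (4 : ℝ) ^ q ≤ 4 ^ (2 : ℝ) := Real.rpow_le_rpow_of_exponent_le (by norm_num) hq2
        _ = 16 := by norm_num
    rw [Real.mul_rpow (by norm_num) hR0.le] at e1
    have e3 := mul_le_mul_of_nonneg_right e2 (Real.rpow_nonneg hR0.le q)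
    calc C * (1 + ‖x‖ + |y|) ^ q ≤ C * (16 * R ^ q) :=
          mul_le_mul_of_nonneg_left (e1.trans e3) hC
      _ = _ := by ring
  have h := slope_le_of_antitone_weighted (f := fun t => u (x, t)) (f' := fun t => dY u (x, t))
    hb (fun t ht => hC2.hasPurePartials.y1 x t ht) (hw x) h1 h12 h2R
  refine le_trans ?_ h
  rw [← neg_mul]
  apply mul_le_mul_of_nonneg_right _ (sub_nonneg.2 (Real.rpow_le_rpow h1.le h12 hb.le))
  have h2b : (1 : ℝ) < 2 ^ b := Real.one_lt_rpow (by norm_num) hb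
  have hden : (2 * R) ^ b - R ^ b = (2 ^ b - 1) * R ^ b := by
    rw [Real.mul_rpow (by norm_num) hR0.le]; ring
  have hRb : 0 < R ^ b := Real.rpow_pos_of_pos hR0 b
  rw [hden, le_div_iff₀ (mul_pos (by linarith) hRb), Real.rpow_sub hR0]
  have e1 := abs_le.1 (hbd (2 * R) (by linarith) le_rfl)
  have e2 := abs_le.1 (hbd R hR0 (by linarith))
  have e3 : -(32 * C / (2 ^ b - 1) * (R ^ q / R ^ b)) * ((2 ^ b - 1) * R ^ b) =
      -(32 * C * R ^ q) := by
    have : (2 : ℝ) ^ b - 1 ≠ 0 := by linarith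
    field_simp
  rw [e3]
  linarith [e1.1, e2.2]

/-- With k = K R^(q - b) the cylinder errors decay like R^(-(2 + b - q)) and R^(-(2 - q)); the
second is where q < 2 is decisive. -/
theorem mono_of_subquadratic_growth {n : ℕ} {u : ExtSpace n → ℝ} {b q C : ℝ}
    (hb0 : 0 < b) (hb2 : b < 2) (hq0 : 0 ≤ q) (hq2 : q < 2) (hC : 0 < C)
    (hcont : ContinuousOn u (closedHalf n)) (hC2 : ContDiffOn ℝ 2 u (openHalf n))
    (heq : ∀ x y, 0 < y →
      ∑ i, dX i (dX i u) (x, y) + dY (dY u) (x, y) + (1 - b) / y * dY u (x, y) = 0)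
    (hw : ∀ x s t, 0 < s → s ≤ t → weightedDY (1 - b) u x t ≤ weightedDY (1 - b) u x s)
    (hgrowth : ∀ p ∈ openHalf n, |u p| ≤ C * (1 + ‖p.1‖ + |p.2|) ^ q)
    (hflux : ∀ x, ∀ η > 0, ∀ᶠ y in 𝓝[>] (0 : ℝ), -η < weightedDY (1 - b) u x y)
    (x : EuclideanSpace ℝ (Fin n)) {y₁ y₂ : ℝ} (h1 : 0 < y₁) (h12 : y₁ ≤ y₂) :
    u (x, y₁) ≤ u (x, y₂) := by
  have h2b : (1 : ℝ) < 2 ^ b := Real.one_lt_rpow (by norm_num) hb0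
  set K := 32 * C / (2 ^ b - 1) with hK
  have hK0 : 0 < K := div_pos (by positivity) (by linarith)
  have hev : ∀ᶠ R in atTop, u (x, y₁) - u (x, y₂) ≤
      K * ‖x‖ ^ 2 * (y₂ ^ b - y₁ ^ b) * R ^ (-(2 + b - q)) +
      (2 * n + 3) * K * (y₂ ^ 2 - y₁ ^ 2) * R ^ (-(2 - q)) := by
    filter_upwards [eventually_ge_atTop 1, eventually_ge_atTop ‖x‖, eventually_ge_atTop y₂]
      with R hR hxR hyR
    have hR0 : 0 < R := by linarith
    have h := hC2.hasPurePartials.sub_le_of_slope_bound hb0 hb2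
      (k := K * R ^ (q - b)) (by positivity) hR0 hcont heq hflux
      (fun z s t hz hs hst ht =>
        slope_bound_of_growth hC2 hb0 hq0 hq2.le hC.le hw hgrowth hR hz hs hst.le ht)
      hxR h1 h12 hyR
    refine h.trans_eq ?_
    have e1 : R ^ (-(2 + b - q)) = R ^ (q - b) / R ^ 2 := by
      rw [show -(2 + b - q) = (q - b) - (2 : ℕ) by push_cast; ring, Real.rpow_sub hR0,
        Real.rpow_natCast]
    have e2 : R ^ (-(2 - q)) = R ^ (q - b) * R ^ (b - 2) := by
      rw [← Real.rpow_add hR0]; congr 1; ring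
    rw [e1, e2]
    ring
  have hlim : Tendsto (fun R : ℝ =>
      K * ‖x‖ ^ 2 * (y₂ ^ b - y₁ ^ b) * R ^ (-(2 + b - q)) +
      (2 * n + 3) * K * (y₂ ^ 2 - y₁ ^ 2) * R ^ (-(2 - q))) atTop (𝓝 0) := by
    have := ((tendsto_rpow_neg_atTop (by linarith : 0 < 2 + b - q)).const_mul
      (K * ‖x‖ ^ 2 * (y₂ ^ b - y₁ ^ b))).add
      ((tendsto_rpow_neg_atTop (by linarith : 0 < 2 - q)).const_mul
      ((2 * n + 3) * K * (y₂ ^ 2 - y₁ ^ 2)))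
    simpa using this
  linarith [ge_of_tendsto hlim hev]

theorem le_of_mono_openHalf {n : ℕ} {u : ExtSpace n → ℝ} (hcont : ContinuousOn u (closedHalf n))
    (x : EuclideanSpace ℝ (Fin n))
    (hmono : ∀ y₁ y₂, 0 < y₁ → y₁ ≤ y₂ → u (x, y₁) ≤ u (x, y₂)) {y : ℝ} (hy : 0 < y) :
    u (x, 0) ≤ u (x, y) := by
  have hc : Tendsto (fun t : ℝ => u (x, t)) (𝓝[>] 0) (𝓝 (u (x, 0))) :=
    ((continuousOn_slice hcont x) 0 Set.self_mem_Ici).mono_left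
      (nhdsWithin_mono _ Set.Ioi_subset_Ici_self)
  refine le_of_tendsto hc ?_
  filter_upwards [Ioo_mem_nhdsGT hy] with t ht
  exact hmono t y ht.1 ht.2.le

/-! ### Conclusion -/

theorem lemma3p3 (n : ℕ) (s a : ℝ) (hs0 : 0 < s) (hs1 : s < 1) (ha : a = 1 - 2 * s)
    (u : ExtSpace n → ℝ)
    (hcont : ContinuousOn u (closedHalf n))
    (hC2 : ContDiffOn ℝ 2 u (openHalf n))
    (hL : ∀ p ∈ openHalf n, extOp a u p = 0)
    (hconv : ∀ p ∈ openHalf n, ∀ ξ : EuclideanSpace ℝ (Fin n), 0 ≤ hessX u p ξ ξ)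
    (C ε : ℝ) (hε : 0 < ε)
    (hgrowth : ∀ p ∈ openHalf n, |u p| ≤ C * (1 + ‖p.1‖ + |p.2|) ^ (2 - ε))
    (hnonneg : ∀ x : EuclideanSpace ℝ (Fin n), 0 ≤ u (x, 0))
    (hflux : ∀ x : EuclideanSpace ℝ (Fin n), ∃ l : EReal, 0 ≤ l ∧
      Tendsto (fun y : ℝ => (weightedDY a u x y : EReal)) (𝓝[>] 0) (𝓝 l))
    (hzero : u (0, 0) = 0)
    (hflux0 : Tendsto (fun y : ℝ => weightedDY a u 0 y) (𝓝[>] 0) (𝓝 0)) :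
    ∀ p ∈ closedHalf n, u p = 0 := by
  subst ha
  have heq : ∀ x y, 0 < y →
      ∑ i, dX i (dX i u) (x, y) + dY (dY u) (x, y) + (1 - 2 * s) / y * dY u (x, y) = 0 := by
    intro x y hy
    have h := hL (x, y) hy
    rw [hC2.extOp_eq hy] at h
    exact (mul_eq_zero.1 h).resolve_left (Real.rpow_pos_of_pos hy _).ne'
  have hw : ∀ x s' t, 0 < s' → s' ≤ t →
      weightedDY (1 - 2 * s) u x t ≤ weightedDY (1 - 2 * s) u x s' :=
    fun x _ _ h1 h2 => antitone_weightedDY hC2 heq hconv x h1 h2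
  have hC : 0 ≤ C := by
    have h := (abs_nonneg _).trans (hgrowth (0, 1) (zero_lt_one : (0 : ℝ) < 1))
    exact nonneg_of_mul_nonneg_left h (by positivity)
  -- The exponent is clipped at 0 to cover ε > 2, harmless because the base is at least 1; C + 1
  -- makes the constant strictly positive.
  have hgrowth' : ∀ p ∈ openHalf n,
      |u p| ≤ (C + 1) * (1 + ‖p.1‖ + |p.2|) ^ (max (2 - ε) 0) := by
    intro p hp
    refine (hgrowth p hp).trans (mul_le_mul (by linarith) ?_ (by positivity) (by linarith))
    exact Real.rpow_le_rpow_of_exponent_le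
      (by linarith [norm_nonneg p.1, abs_nonneg p.2]) (le_max_left _ _)
  have hflux' : ∀ x, ∀ η > 0, ∀ᶠ y in 𝓝[>] (0 : ℝ), -η < weightedDY (1 - 2 * s) u x y := by
    intro x η hη
    obtain ⟨l, hl, hlim⟩ := hflux x
    have hlt : ((-η : ℝ) : EReal) < l :=
      lt_of_lt_of_le (by exact_mod_cast neg_lt_zero.2 hη) hl
    exact (hlim.eventually (lt_mem_nhds hlt)).mono fun y hy => EReal.coe_lt_coe_iff.1 hy
  have hmono : ∀ x y₁ y₂, 0 < y₁ → y₁ ≤ y₂ → u (x, y₁) ≤ u (x, y₂) := fun x _ _ h1 h12 =>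
    mono_of_subquadratic_growth (by linarith) (by linarith) (le_max_right _ _)
      (max_lt (by linarith) two_pos) (by linarith : 0 < C + 1) hcont hC2 heq hw hgrowth' hflux'
      x h1 h12
  have hbase : ∀ x y, 0 < y → u (x, 0) ≤ u (x, y) := fun x y hy =>
    le_of_mono_openHalf hcont x (hmono x) hy
  have hnn : ∀ p ∈ openHalf n, 0 ≤ u p := fun ⟨x, y⟩ hp => (hnonneg x).trans (hbase x y hp)
  have haxis : ∀ y, 0 < y → u (0, y) = 0 := by
    intro y hy
    refine le_antisymm ?_ (hnn (0, y) hy)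
    have hw0 : ∀ t, 0 < t → weightedDY (1 - 2 * s) u 0 t ≤ 0 := fun t ht =>
      ge_of_tendsto hflux0 <| by
        filter_upwards [Ioo_mem_nhdsGT ht] with τ hτ using hw 0 τ t hτ.1 hτ.2.le
    have hanti : AntitoneOn (fun t : ℝ => u (0, t)) (Set.Ici 0) := by
      refine antitoneOn_of_deriv_nonpos (convex_Ici _) (continuousOn_slice hcont 0)
        (fun t ht => ?_) fun t ht => ?_ <;> rw [interior_Ici] at ht
      · exact (hC2.hasPurePartials.y1 0 t ht).differentiableAt.differentiableWithinAt
      · rw [(hC2.hasPurePartials.y1 0 t ht).deriv]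
        exact nonpos_of_mul_nonpos_right (hw0 t ht) (Real.rpow_pos_of_pos ht _)
    have := hanti Set.self_mem_Ici hy.le hy.le
    simp only at this
    rwa [hzero] at this
  have hopen : ∀ x y, 0 < y → u (x, y) = 0 := by
    intro x y hy
    by_contra hne
    have hpos : 0 < u (x, y) := lt_of_le_of_ne (hnn (x, y) hy) (Ne.symm hne)
    -- Height at least y preserves positivity by monotonicity; height at least 2‖x‖ puts the axis
    -- within reach Y / 2.
    have hY : 0 < max y (2 * ‖x‖) := lt_max_of_lt_left hy
    have h := hC2.hasPurePartials.pos_of_pos (a := 1 - 2 * s)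
      (abs_le.2 ⟨by linarith, by linarith⟩) hC2.continuousOn heq hnn hY
      (hpos.trans_le (hmono x y _ hy (le_max_left _ _))) (x := 0)
      (by rw [zero_sub, norm_neg]; linarith [le_max_right y (2 * ‖x‖)])
    exact h.ne' (haxis _ hY)
  rintro ⟨x, y⟩ hp
  rcases (show (0 : ℝ) ≤ y from hp).eq_or_lt with rfl | hy
  · exact le_antisymm ((hbase x 1 one_pos).trans_eq (hopen x 1 one_pos)) (hnonneg x)
  · exact hopen x y hy
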